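/- \textbf{Monotonicity Lemma.} Let $m>1$, $-2<\sigma<0$, $1\leq p<1-\frac{\sigma(m-1)}{2}$, and let $N\geq2$ be an integer, or $N=1$ and $\sigma>-1$. Set $$ \alpha=-\frac{\sigma+2}{\sigma(m-1)+2(p-1)}>0,\qquad \beta=-\frac{m-p}{\sigma(m-1)+2(p-1)}>0 . $$ A \emph{profile} is a continuous function $f:[0,\infty)\to\mathbb{R}$ which, as long as it stays positive (that is, at every $\xi>0$ such that $f>0$ on $(0,\xi]$), is of class $C^2$ and satisfies $$ (f^m)''(\xi)+\frac{N-1}{\xi}(f^m)'(\xi)-\alpha f(\xi)+\beta\xi f'(\xi)+\xi^{\sigma}f(\xi)^p=0, $$ and which has, for some $D>0$, the local behavior at the origin $$ f(\xi)\sim\left[D-\frac{m-p}{m(N+\sigma)(\sigma+2)}\,\xi^{\sigma+2}\right]^{1/(m-p)}\qquad\text{as }\xi\to0^+, $$ where $\sim$ means that the quotient tends to $1$; if $N=1$, it is required in addition that $f(\xi)^{m-p}=D-\frac{m-p}{m(1+\sigma)(\sigma+2)}\xi^{\sigma+2}+o(\xi^{\sigma+2})$. Let $f_1$, $f_2$ be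 two profiles with $f_1(0)<f_2(0)$. Let $\xi_{\min}\in(0,\infty)$ be such that either $f_1(\xi_{\min})=0$ and $f_1>0$ on $(0,\xi_{\min})$, or $f_1(\xi_{\min})>0$ is the minimum of $f_1$ over $(0,\infty)$. Then $f_1(\xi)<f_2(\xi)$ for every $\xi\in(0,\xi_{\min})$. -/

import Mathlib

open Filter Topology Asymptotics

noncomputable section

/-- The amplitude exponent `α` of the self-similar solutions `t ^ α * f (|x| * t ^ (-β))`. -/
def alphaExp (m p σ : ℝ) : ℝ := -(σ + 2) / (σ * (m - 1) + 2 * (p - 1))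

/-- The spatial exponent `β` of the self-similar solutions. -/
def betaExp (m p σ : ℝ) : ℝ := -(m - p) / (σ * (m - 1) + 2 * (p - 1))

/-- `f` is twice continuously differentiable near `ξ` and satisfies at `ξ` the equation
`(f^m)'' + (N-1)/ξ (f^m)' - α f + β ξ f' + ξ^σ f^p = 0`. -/
def SolvesODEAt (N : ℕ) (m p σ : ℝ) (f : ℝ → ℝ) (ξ : ℝ) : Prop :=
  ContDiffAt ℝ 2 f ξ ∧
    deriv (deriv fun s => f s ^ m) ξ + ((N : ℝ) - 1) / ξ * deriv (fun s => f s ^ m) ξ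
      - alphaExp m p σ * f ξ + betaExp m p σ * ξ * deriv f ξ + ξ ^ σ * f ξ ^ p = 0

/-- The coefficient `(m-p) / (m (N+σ) (σ+2))` of `ξ ^ (σ+2)` in the behavior at the origin. -/
def originCoeff (N : ℕ) (m p σ : ℝ) : ℝ := (m - p) / (m * (N + σ) * (σ + 2))

/-- The local behavior `f(ξ) ∼ [D - K ξ^(σ+2)]^(1/(m-p))` as `ξ → 0`, `ξ > 0`, with
`K = originCoeff N m p σ` and some `D > 0`.
In dimension one, solutions with `f(ξ) = (D + C ξ + ⋯)^(1/(m-p))`, `C ≠ 0`, exist as well and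
are not meant; so there the relation is read as an expansion up to the order `ξ ^ (σ+2)`. -/
def HasOriginBehavior (N : ℕ) (m p σ : ℝ) (f : ℝ → ℝ) : Prop :=
  ∃ D : ℝ, 0 < D ∧
    (f ~[𝓝[>] 0] fun ξ => (D - originCoeff N m p σ * ξ ^ (σ + 2)) ^ (1 / (m - p))) ∧
    (N = 1 → (fun ξ => f ξ ^ (m - p) - (D - originCoeff N m p σ * ξ ^ (σ + 2)))
      =o[𝓝[>] 0] fun ξ => ξ ^ (σ + 2))

/-- A profile: a function continuous on `[0, ∞)`, with the above behavior at the origin, that is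
a classical solution of the equation for as long as it stays positive (a profile may reach zero
at a finite point, with an interface or with a change of sign). -/
structure IsProfile (N : ℕ) (m p σ : ℝ) (f : ℝ → ℝ) : Prop where
  continuousOn : ContinuousOn f (Set.Ici 0)
  solves : ∀ ξ : ℝ, 0 < ξ → (∀ s ∈ Set.Ioc 0 ξ, 0 < f s) → SolvesODEAt N m p σ f ξ
  origin : HasOriginBehavior N m p σ f

/-- `ξmin` is the first zero of `f` on `(0, ∞)`, or `f` has a positive minimum over `(0, ∞)`
and attains it at `ξmin`. -/
def IsZeroOrPositiveMin (f : ℝ → ℝ) (ξmin : ℝ) : Prop :=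
  0 < ξmin ∧
    ((f ξmin = 0 ∧ ∀ s ∈ Set.Ioo 0 ξmin, 0 < f s) ∨
      (0 < f ξmin ∧ IsMinOn f (Set.Ioi 0) ξmin))

end

/-! The proof is a sliding argument along the dilations `g_l(x) = l^(-k) f₁(l x)`, `k = 2/(m-1)`.
They preserve every term of the equation except the reaction, whose coefficient becomes `l^(σ +
k(p-1))`. The bound on `p` makes this exponent negative, so the coefficient exceeds 1 when `l < 1`.

Suppose the order fails and let `b` be the first point where `f₁ ≥ f₂`. For small `l`, `g_l` lies
above `f₂` on `[0, b]`. Increase `l` to the first contact (`exists_first_contact`); it occurs at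
some `l < 1`, because `f₁(0) < f₂(0)`. Each location of the contact point is impossible. Interior:
comparison at a touching point (`profileResidual_le_of_touching`) contradicts the larger reaction
coefficient. At `b`: `f₂(b) ≤ f₁(b)` contradicts the strict decrease of `x^(-k) f₁(x)`
(`mul_rpow_neg_lt_of_solution`). At `0`: the stronger reaction pushes `g_l` below `f₂` near the
origin. This is seen from the flux if `N ≥ 2` (`not_le_near_origin`), and from the expansion if `N =
1` (`IsProfile.not_le_dilate_near_origin`). -/

/-- The left-hand side of the profile equation, with the reaction term multiplied by `c`. -/
noncomputable def profileResidual (N : ℕ) (m p σ c : ℝ) (f : ℝ → ℝ) (ξ : ℝ) : ℝ :=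
  deriv (deriv fun s => f s ^ m) ξ + ((N : ℝ) - 1) / ξ * deriv (fun s => f s ^ m) ξ
    - alphaExp m p σ * f ξ + betaExp m p σ * ξ * deriv f ξ + c * (ξ ^ σ * f ξ ^ p)

/-- The rescaling that leaves all terms of the profile equation but the reaction invariant. -/
noncomputable def dilate (k l : ℝ) (f : ℝ → ℝ) (x : ℝ) : ℝ := l ^ (-k) * f (l * x)

/-! ### Comparison at a touching point -/

theorem deriv_deriv_nonneg_of_isLocalMin {w : ℝ → ℝ} {s : ℝ} (hw : ContDiffAt ℝ 2 w s)
    (h : IsLocalMin w s) : 0 ≤ deriv (deriv w) s := by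
  by_contra! hneg
  -- A negative second derivative would make `s` a local maximum too, so `w` would be locally
  -- constant.
  have hmax := isLocalMax_of_deriv_deriv_neg hneg h.deriv_eq_zero hw.continuousAt
  have hconst : w =ᶠ[𝓝 s] fun _ => w s := by
    filter_upwards [h, hmax] with x h1 h2 using le_antisymm h2 h1
  have h2 := hconst.deriv.deriv_eq
  simp at h2
  linarith

theorem ContDiffAt.differentiableAt_deriv {w : ℝ → ℝ} {s : ℝ} (hw : ContDiffAt ℝ 2 w s) :
    DifferentiableAt ℝ (deriv w) s := by
  have h1 : ContDiffAt ℝ 1 (fderiv ℝ w) s := hw.fderiv_right (by norm_num)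
  exact (h1.differentiableAt (by norm_num)).clm_apply (differentiableAt_const (1 : ℝ))

theorem ContDiffAt.eventually_differentiableAt {w : ℝ → ℝ} {s : ℝ} (hw : ContDiffAt ℝ 2 w s) :
    ∀ᶠ x in 𝓝 s, DifferentiableAt ℝ w x := by
  filter_upwards [hw.eventually (by simp)] with x hx using hx.differentiableAt (by norm_num)

/-- At the contact point values and first derivatives agree, and `u^m - v^m` has a local minimum, so
only the second-order terms can differ. -/
theorem profileResidual_le_of_touching {N : ℕ} {m p σ c s : ℝ} {u v : ℝ → ℝ}
    (hm : 0 ≤ m) (hu : ContDiffAt ℝ 2 u s) (hv : ContDiffAt ℝ 2 v s) (heq : u s = v s)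
    (hpos : 0 < v s) (hle : ∀ᶠ x in 𝓝 s, v x ≤ u x) :
    profileResidual N m p σ c v s ≤ profileResidual N m p σ c u s := by
  have hum : ContDiffAt ℝ 2 (fun x => u x ^ m) s := hu.rpow_const_of_ne (by rw [heq]; exact hpos.ne')
  have hvm : ContDiffAt ℝ 2 (fun x => v x ^ m) s := hv.rpow_const_of_ne hpos.ne'
  have hvpos : ∀ᶠ x in 𝓝 s, 0 < v x := hv.continuousAt.eventually (lt_mem_nhds hpos)
  have h1 : IsLocalMin (fun x => u x - v x) s := by
    filter_upwards [hle] with x hx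
    simp only [heq]; linarith
  have h2 : IsLocalMin (fun x => u x ^ m - v x ^ m) s := by
    filter_upwards [hle, hvpos] with x hx hx0
    simp only [heq, sub_self]
    linarith [Real.rpow_le_rpow hx0.le hx hm]
  have d1 := h1.deriv_eq_zero
  rw [deriv_fun_sub (hu.differentiableAt (by norm_num)) (hv.differentiableAt (by norm_num))] at d1
  have d2 := h2.deriv_eq_zero
  rw [deriv_fun_sub (hum.differentiableAt (by norm_num)) (hvm.differentiableAt (by norm_num))] at d2
  have d3 := deriv_deriv_nonneg_of_isLocalMin (hum.sub hvm) h2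
  have e : deriv (fun x => u x ^ m - v x ^ m) =ᶠ[𝓝 s]
      fun x => deriv (fun x => u x ^ m) x - deriv (fun x => v x ^ m) x := by
    filter_upwards [hum.eventually_differentiableAt, hvm.eventually_differentiableAt] with x a b
      using deriv_fun_sub a b
  rw [e.deriv_eq, deriv_fun_sub (ContDiffAt.differentiableAt_deriv hum)
    (ContDiffAt.differentiableAt_deriv hvm)] at d3
  unfold profileResidual
  rw [sub_eq_zero.1 d1, sub_eq_zero.1 d2, heq]
  linarith

/-! ### Scaling and the power barrier -/

/-- The choice of `k` gives `k m = k + 2`, so diffusion scales by `l^(-k)` like the terms in `α` and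
`β`. -/
theorem profileResidual_dilate {N : ℕ} {m p σ l x : ℝ} {f : ℝ → ℝ} (hm : 1 < m) (hl : 0 < l) (hx : 0 < x)
    (hf : ContinuousAt f (l * x)) (hpos : 0 < f (l * x)) :
    profileResidual N m p σ (l ^ (σ + 2 / (m - 1) * (p - 1))) (dilate (2 / (m - 1)) l f) x
      = l ^ (-(2 / (m - 1))) * profileResidual N m p σ 1 f (l * x) := by
  set k := 2 / (m - 1) with hk
  have hkm : k * m = k + 2 := by
    have : m - 1 ≠ 0 := by linarith
    rw [hk]; field_simp; ring
  have hlx : ContinuousAt (fun y => l * y) x := by fun_prop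
  have hev : ∀ᶠ y in 𝓝 x, 0 < f (l * y) :=
    (ContinuousAt.comp (f := fun y => l * y) (g := f) hf hlx).eventually (lt_mem_nhds hpos)
  have e1 : (fun y => dilate k l f y ^ m) =ᶠ[𝓝 x]
      fun y => l ^ (-(k + 2)) * (fun z => f z ^ m) (l * y) := by
    filter_upwards [hev] with y hy
    simp only [dilate]
    rw [Real.mul_rpow (by positivity) hy.le, ← Real.rpow_mul hl.le, neg_mul, hkm]
  have e2 : deriv (fun y => dilate k l f y ^ m) =ᶠ[𝓝 x]
      fun y => l ^ (-(k + 2)) * (l * deriv (fun z => f z ^ m) (l * y)) := by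
    filter_upwards [e1.deriv] with y hy
    rw [hy, deriv_const_mul_field, deriv_comp_mul_left l (fun z => f z ^ m)]
    simp
  have e3 : deriv (deriv (fun y => dilate k l f y ^ m)) x
      = l ^ (-(k + 2)) * (l * (l * deriv (deriv (fun z => f z ^ m)) (l * x))) := by
    rw [e2.deriv_eq, deriv_const_mul_field, deriv_const_mul_field,
      deriv_comp_mul_left l (deriv (fun z => f z ^ m))]
    simp
  have e4 : deriv (dilate k l f) x = l ^ (-k) * (l * deriv f (l * x)) := by
    unfold dilate
    rw [deriv_const_mul_field, deriv_comp_mul_left l f]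
    simp
  have e5 : l ^ (-(k + 2)) * l * l = l ^ (-k) := by
    rw [← Real.rpow_add_one hl.ne', ← Real.rpow_add_one hl.ne']
    ring_nf
  have e6 : l ^ (σ + k * (p - 1)) * (l ^ (-k)) ^ p = l ^ (-k) * l ^ σ := by
    rw [← Real.rpow_mul hl.le, ← Real.rpow_add hl, ← Real.rpow_add hl]
    ring_nf
  unfold profileResidual
  rw [e3, e2.self_of_nhds, e4]
  have e7 : dilate k l f x ^ p = (l ^ (-k)) ^ p * f (l * x) ^ p := by
    simp only [dilate]
    rw [Real.mul_rpow (by positivity) hpos.le]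
  rw [e7, Real.mul_rpow hl.le hx.le]
  have e8 : ((N : ℝ) - 1) / x = ((N : ℝ) - 1) / (l * x) * l := by field_simp
  rw [e8]
  simp only [dilate]
  generalize deriv (deriv (fun z => f z ^ m)) (l * x) = A
  generalize deriv (fun z => f z ^ m) (l * x) = B
  generalize deriv f (l * x) = C
  linear_combination (A + ((N : ℝ) - 1) / (l * x) * B) * e5 + (x ^ σ * f (l * x) ^ p) * e6

theorem contDiffAt_dilate {k l x : ℝ} {f : ℝ → ℝ} (hf : ContDiffAt ℝ 2 f (l * x)) :
    ContDiffAt ℝ 2 (dilate k l f) x := by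
  have h : ContDiffAt ℝ 2 (fun y => l * y) x := by fun_prop
  exact contDiffAt_const.mul (ContDiffAt.comp x hf h)

theorem scaling_exponents {m p σ : ℝ} (hm : 1 < m) (hσ : -2 < σ)
    (hpc : p < 1 - σ * (m - 1) / 2) :
    p < m ∧ σ + 2 / (m - 1) * (p - 1) < 0 ∧ 0 < betaExp m p σ ∧
      2 / (m - 1) * betaExp m p σ - alphaExp m p σ = 1 / (m - 1) ∧
      σ + 2 - 2 / (m - 1) * (m - p) = σ + 2 / (m - 1) * (p - 1) := by
  have hm1 : 0 < m - 1 := by linarith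
  have hq : σ * (m - 1) + 2 * (p - 1) < 0 := by linarith
  have hpm : p < m := by nlinarith
  refine ⟨hpm, ?_, ?_, ?_, ?_⟩
  · have : σ + 2 / (m - 1) * (p - 1) = (σ * (m - 1) + 2 * (p - 1)) / (m - 1) := by field_simp
    rw [this]
    exact div_neg_of_neg_of_pos hq hm1
  · exact div_pos_of_neg_of_neg (by linarith) hq
  · unfold betaExp alphaExp
    have hne := hq.ne
    generalize hqd : σ * (m - 1) + 2 * (p - 1) = q at hne
    field_simp
    linarith
  · field_simp
    ring

/-- Since `kβ - α = 1/(m-1) > 0`, the zeroth-order and drift terms add up to something positive, as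
are diffusion and reaction: `C x^k` is a strict subsolution. -/
theorem profileResidual_power_pos {N : ℕ} {m p σ C s : ℝ} (hm : 1 < m) (hσ : -2 < σ)
    (hpc : p < 1 - σ * (m - 1) / 2) (hN : 1 ≤ N) (hC : 0 < C) (hs : 0 < s) :
    0 < profileResidual N m p σ 1 (fun x => C * x ^ (2 / (m - 1))) s := by
  obtain ⟨-, -, -, hαβ, -⟩ := scaling_exponents hm hσ hpc
  have hm1 : 0 < m - 1 := by linarith
  set k := 2 / (m - 1) with hk
  have hk0 : 0 < k := by positivity
  have hkm : k * m = k + 2 := by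
    rw [hk]; field_simp; ring
  have e1 : (fun y : ℝ => (C * y ^ k) ^ m) =ᶠ[𝓝 s] fun y => C ^ m * y ^ (k + 2) := by
    filter_upwards [lt_mem_nhds hs] with y hy
    rw [Real.mul_rpow hC.le (by positivity), ← Real.rpow_mul hy.le, hkm]
  have e2 : deriv (fun y : ℝ => (C * y ^ k) ^ m) =ᶠ[𝓝 s]
      fun y => C ^ m * ((k + 2) * y ^ (k + 1)) := by
    filter_upwards [e1.deriv, lt_mem_nhds hs] with y hy hy0
    rw [hy, deriv_const_mul_field, Real.deriv_rpow_const]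
    ring_nf
  have e3 : deriv (deriv (fun y : ℝ => (C * y ^ k) ^ m)) s
      = C ^ m * ((k + 2) * ((k + 1) * s ^ k)) := by
    rw [e2.deriv_eq, deriv_const_mul_field, deriv_const_mul_field, Real.deriv_rpow_const]
    ring_nf
  have e4 : deriv (fun x : ℝ => C * x ^ k) s = C * (k * s ^ (k - 1)) := by
    rw [deriv_const_mul_field, Real.deriv_rpow_const]
  have e5 : s * s ^ (k - 1) = s ^ k := by
    rw [mul_comm, ← Real.rpow_add_one hs.ne']; ring_nf
  unfold profileResidual
  rw [e3, e2.self_of_nhds, e4]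
  have e6 : - alphaExp m p σ * (C * s ^ k) + betaExp m p σ * s * (C * (k * s ^ (k - 1)))
      = 1 / (m - 1) * (C * s ^ k) := by
    linear_combination (betaExp m p σ * C * k) * e5 + (C * s ^ k) * hαβ
  have hN' : (0 : ℝ) ≤ (N : ℝ) - 1 := by
    have : (1 : ℝ) ≤ N := by exact_mod_cast hN
    linarith
  have p1 : 0 < C ^ m * ((k + 2) * ((k + 1) * s ^ k)) := by positivity
  have p2 : 0 ≤ ((N : ℝ) - 1) / s * (C ^ m * ((k + 2) * s ^ (k + 1))) := by positivity
  have p3 : 0 < 1 / (m - 1) * (C * s ^ k) := by positivity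
  have p4 : 0 < 1 * (s ^ σ * (C * s ^ k) ^ p) := by positivity
  linarith

/-- The quotient `f x^(-k)` blows up at 0, so if it failed to decrease it would have an interior
minimum, where a strict subsolution `C x^k` touches `f` from below. -/
theorem mul_rpow_neg_lt_of_solution {N : ℕ} {m p σ t s s' : ℝ} {f : ℝ → ℝ} (hm : 1 < m)
    (hσ : -2 < σ) (hpc : p < 1 - σ * (m - 1) / 2) (hN : 1 ≤ N)
    (hc : ContinuousOn f (Set.Ici 0)) (h0 : 0 < f 0) (hpos : ∀ x ∈ Set.Ioo 0 t, 0 < f x)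
    (hsol : ∀ x ∈ Set.Ioo 0 t, ContDiffAt ℝ 2 f x ∧ profileResidual N m p σ 1 f x = 0)
    (hs : 0 < s) (hss : s < s') (hst : s' < t) :
    f s' * s' ^ (-(2 / (m - 1))) < f s * s ^ (-(2 / (m - 1))) := by
  by_contra! hcon
  have hm1 : 0 < m - 1 := by linarith
  set k := 2 / (m - 1) with hk
  have hk0 : 0 < k := by positivity
  have hlim : Tendsto (fun x : ℝ => f x * x ^ (-k)) (𝓝[>] 0) atTop := by
    have h1 : Tendsto f (𝓝[>] 0) (𝓝 (f 0)) :=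
      (hc 0 Set.self_mem_Ici).mono_left (nhdsWithin_mono _ Set.Ioi_subset_Ici_self)
    exact h1.pos_mul_atTop h0 (tendsto_rpow_neg_nhdsGT_zero (by linarith))
  -- The value at `e` exceeds that at `s`, which keeps the minimum off the left endpoint.
  obtain ⟨e, ⟨hes, he⟩⟩ := ((hlim.eventually_gt_atTop (f s * s ^ (-k))).and
    (Ioo_mem_nhdsGT hs)).exists
  have hcont : ContinuousOn (fun x : ℝ => f x * x ^ (-k)) (Set.Icc e s') := by
    refine (hc.mono fun x hx => he.1.le.trans hx.1).mul ?_
    exact continuousOn_id.rpow_const fun x hx => Or.inl (he.1.trans_le hx.1).ne'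
  have key : ∃ z ∈ Set.Ioo e s', ∀ x ∈ Set.Icc e s', f z * z ^ (-k) ≤ f x * x ^ (-k) := by
    obtain ⟨z, hz, hzmin⟩ := isCompact_Icc.exists_isMinOn
      (Set.nonempty_Icc.2 (he.2.le.trans hss.le)) hcont
    have hzs := hzmin (show s ∈ Set.Icc e s' from ⟨he.2.le, hss.le⟩)
    simp only [Set.mem_ofPred_eq] at hzs
    -- If the minimum is at `s'`, then `hcon` makes `s` a minimum as well.
    rcases eq_or_lt_of_le hz.2 with h | h
    · refine ⟨s, ⟨he.2, hss⟩, fun x hx => ?_⟩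
      rw [h] at hzmin
      exact hcon.trans (hzmin hx)
    · refine ⟨z, ⟨lt_of_le_of_ne hz.1 ?_, h⟩, fun x hx => hzmin hx⟩
      rintro rfl
      linarith
  obtain ⟨z, hz, hzmin⟩ := key
  have hz0 : 0 < z := he.1.trans hz.1
  have hzt : z ∈ Set.Ioo 0 t := ⟨hz0, hz.2.trans hst⟩
  have hfz := hpos z hzt
  have hcancel : ∀ x : ℝ, 0 < x → f x * x ^ (-k) * x ^ k = f x := fun x hx => by
    rw [mul_assoc, ← Real.rpow_add hx]; simp
  have hC : 0 < f z * z ^ (-k) := by positivity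
  have hP := profileResidual_power_pos (p := p) hm hσ hpc hN hC hz0
  have hle := profileResidual_le_of_touching (N := N) (m := m) (p := p) (σ := σ) (c := 1) (s := z) (u := f)
    (v := fun x => f z * z ^ (-k) * x ^ k) (by linarith) (hsol z hzt).1
    (contDiffAt_const.mul (contDiffAt_id.rpow_const_of_ne hz0.ne')) (hcancel z hz0).symm
    (by positivity) (by
      filter_upwards [Ioo_mem_nhds hz.1 hz.2] with x hx
      have hx0 : 0 < x := he.1.trans hx.1
      calc f z * z ^ (-k) * x ^ k ≤ f x * x ^ (-k) * x ^ k := by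
            gcongr ?_ * _
            exact hzmin x ⟨hx.1.le, hx.2.le⟩
        _ = f x := hcancel x hx0)
  rw [(hsol z hzt).2] at hle
  linarith

/-! ### Contact at the origin, `N ≥ 2` -/

/-- The flux `r ^ (N-1) (f^m)' + β r ^ N f`. -/
noncomputable def profileFlux (N : ℕ) (m p σ : ℝ) (f : ℝ → ℝ) (r : ℝ) : ℝ :=
  r ^ ((N : ℝ) - 1) * deriv (fun s => f s ^ m) r + betaExp m p σ * (r ^ (N : ℝ) * f r)

theorem hasDerivAt_profileFlux {N : ℕ} {m p σ r : ℝ} (c : ℝ) {f : ℝ → ℝ} (hr : 0 < r)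
    (hf : ContDiffAt ℝ 2 f r) (hpos : 0 < f r) :
    HasDerivAt (profileFlux N m p σ f)
      (r ^ ((N : ℝ) - 1) * (profileResidual N m p σ c f r
        + (alphaExp m p σ + N * betaExp m p σ) * f r - c * (r ^ σ * f r ^ p))) r := by
  have hfm : ContDiffAt ℝ 2 (fun x => f x ^ m) r := hf.rpow_const_of_ne hpos.ne'
  have h1 : HasDerivAt (fun x : ℝ => x ^ ((N : ℝ) - 1)) _ r :=
    Real.hasDerivAt_rpow_const (Or.inl hr.ne')
  have h2 : HasDerivAt (fun x : ℝ => x ^ (N : ℝ)) _ r :=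
    Real.hasDerivAt_rpow_const (Or.inl hr.ne')
  have h3 := (hf.differentiableAt (by norm_num)).hasDerivAt
  have h4 := hfm.differentiableAt_deriv.hasDerivAt
  refine ((h1.mul h4).add ((h2.mul h3).const_mul (betaExp m p σ))).congr_deriv ?_
  have e1 : r ^ (N : ℝ) = r ^ ((N : ℝ) - 1) * r := by
    rw [← Real.rpow_add_one hr.ne']; ring_nf
  have e2 : r ^ ((N : ℝ) - 1) = r ^ ((N : ℝ) - 1 - 1) * r := by
    rw [← Real.rpow_add_one hr.ne']; ring_nf
  have e3 : r ^ ((N : ℝ) - 1 - 1) = r ^ ((N : ℝ) - 1) / r := by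
    rw [e2]; field_simp
  unfold profileResidual
  rw [e1, e3]
  field_simp
  ring

/-- Two functions that agree at the origin and solve the equation with different reaction
coefficients are not ordered in favor of the larger coefficient. -/
theorem not_le_near_origin {N : ℕ} {m p σ c δ A : ℝ} {f g : ℝ → ℝ} (hm : 0 < m) (hσ0 : σ < 0)
    (hβ : 0 < betaExp m p σ) (hN : 2 ≤ N) (hc : 1 < c) (hδ : 0 < δ) (hA : 0 < A)
    (hf : Tendsto f (𝓝[>] 0) (𝓝 A)) (hg : Tendsto g (𝓝[>] 0) (𝓝 A))
    (hfs : ∀ x ∈ Set.Ioo 0 δ, 0 < f x ∧ ContDiffAt ℝ 2 f x ∧ profileResidual N m p σ 1 f x = 0)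
    (hgs : ∀ x ∈ Set.Ioo 0 δ, ContDiffAt ℝ 2 g x ∧ profileResidual N m p σ c g x = 0)
    (hle : ∀ x ∈ Set.Ioo 0 δ, f x ≤ g x) : False := by
  set Φ := fun r => profileFlux N m p σ g r - profileFlux N m p σ f r with hΦ
  set w := fun r => g r ^ m - f r ^ m with hw
  have hN2 : (2 : ℝ) ≤ N := by exact_mod_cast hN
  have hgpos : ∀ x ∈ Set.Ioo 0 δ, 0 < g x := fun x hx => (hfs x hx).1.trans_le (hle x hx)
  have hwd : ∀ x ∈ Set.Ioo 0 δ, HasDerivAt w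
      (deriv (fun s => g s ^ m) x - deriv (fun s => f s ^ m) x) x := fun x hx => by
    have h1 : ContDiffAt ℝ 2 (fun s => g s ^ m) x :=
      (hgs x hx).1.rpow_const_of_ne (hgpos x hx).ne'
    have h2 : ContDiffAt ℝ 2 (fun s => f s ^ m) x :=
      (hfs x hx).2.1.rpow_const_of_ne (hfs x hx).1.ne'
    exact (h1.differentiableAt (by norm_num)).hasDerivAt.sub
      (h2.differentiableAt (by norm_num)).hasDerivAt
  have hw0 : ∀ x ∈ Set.Ioo 0 δ, 0 ≤ w x := fun x hx =>
    sub_nonneg.2 (Real.rpow_le_rpow (hfs x hx).1.le (hle x hx) hm.le)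
  have hwlim : Tendsto w (𝓝[>] 0) (𝓝 0) := by
    have := (hg.rpow_const (p := m) (Or.inl hA.ne')).sub (hf.rpow_const (p := m) (Or.inl hA.ne'))
    simpa using this
  have hΦeq : ∀ x, Φ x = x ^ ((N : ℝ) - 1) *
      (deriv (fun s => g s ^ m) x - deriv (fun s => f s ^ m) x)
      + betaExp m p σ * (x ^ (N : ℝ) * (g x - f x)) := fun x => by
    simp only [hΦ, profileFlux]; ring
  have hΦneg : ∀ᶠ x in 𝓝[>] (0 : ℝ), ∃ d < 0, HasDerivAt Φ d x := by
    -- Both functions tend to `A`, so the linear terms cancel and the limit is `-(c-1) A^p < 0`; the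
    -- factor `x^σ ≥ 1` only helps.
    have hlim : Tendsto (fun x => (alphaExp m p σ + N * betaExp m p σ) * (g x - f x)
        - (c * g x ^ p - f x ^ p)) (𝓝[>] 0)
        (𝓝 ((alphaExp m p σ + N * betaExp m p σ) * (A - A) - (c * A ^ p - A ^ p))) :=
      ((hg.sub hf).const_mul _).sub (((hg.rpow_const (Or.inl hA.ne')).const_mul c).sub
        (hf.rpow_const (Or.inl hA.ne')))
    have hAp : 0 < A ^ p := by positivity
    have hlt := hlim.eventually (gt_mem_nhds (show _ < 0 by nlinarith))
    have hlim2 : Tendsto (fun x => c * g x ^ p - f x ^ p) (𝓝[>] 0) (𝓝 (c * A ^ p - A ^ p)) :=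
      ((hg.rpow_const (Or.inl hA.ne')).const_mul c).sub (hf.rpow_const (Or.inl hA.ne'))
    have hgt := hlim2.eventually (lt_mem_nhds (show 0 < _ by nlinarith))
    filter_upwards [hlt, hgt, Ioo_mem_nhdsGT hδ, Ioo_mem_nhdsGT one_pos] with x h1 h2 hx hx1
    refine ⟨_, ?_, (hasDerivAt_profileFlux c hx.1 (hgs x hx).1 (hgpos x hx)).sub
      (hasDerivAt_profileFlux 1 hx.1 (hfs x hx).2.1 (hfs x hx).1)⟩
    rw [(hgs x hx).2, (hfs x hx).2.2]
    have h3 : 1 ≤ x ^ σ := Real.one_le_rpow_of_pos_of_le_one_of_nonpos hx.1 hx1.2.le hσ0.le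
    have h4 : 0 < x ^ ((N : ℝ) - 1) := Real.rpow_pos_of_pos hx.1 _
    have h5 : (c * g x ^ p - f x ^ p) ≤ x ^ σ * (c * g x ^ p - f x ^ p) :=
      le_mul_of_one_le_left h2.le h3
    have h6 := mul_neg_of_pos_of_neg h4 (show (alphaExp m p σ + N * betaExp m p σ) * (g x - f x)
      - x ^ σ * (c * g x ^ p - f x ^ p) < 0 by linarith)
    linarith
  obtain ⟨ε, hε, hεs⟩ := mem_nhdsGT_iff_exists_Ioo_subset.1
    (inter_mem hΦneg (inter_mem (Ioo_mem_nhdsGT hδ) (Ioo_mem_nhdsGT one_pos)))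
  have hε0 : (0 : ℝ) < ε := hε
  have hΦanti : StrictAntiOn Φ (Set.Ioo 0 ε) := by
    refine strictAntiOn_of_deriv_neg (convex_Ioo 0 ε) (fun x hx => ?_) (fun x hx => ?_)
    · obtain ⟨d, -, hd⟩ := (hεs hx).1
      exact hd.continuousAt.continuousWithinAt
    · rw [interior_Ioo] at hx
      obtain ⟨d, hd0, hd⟩ := (hεs hx).1
      rwa [hd.deriv]
  have hΦle : ∀ x ∈ Set.Ioo 0 ε, Φ x ≤ 0 := by
    intro x hx
    -- A positive flux difference would give `w' ≥ η/(2r)` near 0, since `r^(N-1) ≤ r` for `N ≥ 2`.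
    -- Then `w` would tend to `-∞` logarithmically, against `w ≥ 0`.
    by_contra! hη
    set η := Φ x
    have hsmall : ∀ᶠ r in 𝓝[>] (0 : ℝ), betaExp m p σ * (r ^ (N : ℝ) * (g r - f r)) < η / 2 := by
      have hr : Tendsto (fun r : ℝ => r ^ (N : ℝ)) (𝓝[>] 0) (𝓝 0) := by
        have := (Real.continuousAt_rpow_const 0 (N : ℝ) (Or.inr (by linarith))).tendsto
        rw [Real.zero_rpow (by linarith)] at this
        exact this.mono_left nhdsWithin_le_nhds
      have := (hr.mul (hg.sub hf)).const_mul (betaExp m p σ)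
      rw [zero_mul, mul_zero] at this
      exact this.eventually (gt_mem_nhds (by linarith))
    obtain ⟨ρ, hρ, hρs⟩ := mem_nhdsGT_iff_exists_Ioo_subset.1
      (inter_mem hsmall (Ioo_mem_nhdsGT hx.1))
    have hρ0 : (0 : ℝ) < ρ := hρ
    have hsub : ∀ r ∈ Set.Ioo 0 ρ, r ∈ Set.Ioo 0 ε := fun r hr =>
      ⟨hr.1, (hρs hr).2.2.trans hx.2⟩
    have hder : ∀ r ∈ Set.Ioo 0 ρ, η / 2 / r
        ≤ deriv (fun s => g s ^ m) r - deriv (fun s => f s ^ m) r := by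
      intro r hr
      have h1 := hΦanti (hsub r hr) hx (hρs hr).2.2
      have h2 : betaExp m p σ * (r ^ (N : ℝ) * (g r - f r)) < η / 2 := (hρs hr).1
      rw [hΦeq r] at h1
      have h3 : r ^ ((N : ℝ) - 1) ≤ r := by
        have := Real.rpow_le_rpow_of_exponent_ge hr.1 (hεs (hsub r hr)).2.2.2.le
          (show (1 : ℝ) ≤ (N : ℝ) - 1 by linarith)
        rwa [Real.rpow_one] at this
      have h4 : 0 < r ^ ((N : ℝ) - 1) := Real.rpow_pos_of_pos hr.1 _
      set W := deriv (fun s => g s ^ m) r - deriv (fun s => f s ^ m) r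
      have h5 : η / 2 < r ^ ((N : ℝ) - 1) * W := by linarith
      have h6 : 0 < W := pos_of_mul_pos_right (by linarith) h4.le
      rw [div_le_iff₀ hr.1]
      nlinarith
    have hmono : MonotoneOn (fun r => w r - η / 2 * Real.log r) (Set.Ioo 0 ρ) := by
      have hd : ∀ r ∈ Set.Ioo 0 ρ, HasDerivAt (fun r => w r - η / 2 * Real.log r)
          (deriv (fun s => g s ^ m) r - deriv (fun s => f s ^ m) r - η / 2 * r⁻¹) r :=
        fun r hr => (hwd r (hεs (hsub r hr)).2.1).sub
          ((Real.hasDerivAt_log hr.1.ne').const_mul _)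
      refine monotoneOn_of_deriv_nonneg (convex_Ioo 0 ρ)
        (fun r hr => (hd r hr).continuousAt.continuousWithinAt)
        (fun r hr => ?_) (fun r hr => ?_)
      · rw [interior_Ioo] at hr
        exact (hd r hr).differentiableAt.differentiableWithinAt
      · rw [interior_Ioo] at hr
        rw [(hd r hr).deriv]
        have := hder r hr
        rw [div_eq_mul_inv] at this
        linarith
    have hr3 : ρ / 2 ∈ Set.Ioo 0 ρ := ⟨by linarith, by linarith⟩
    have hlog : Tendsto (fun r => w (ρ / 2) - η / 2 * Real.log (ρ / 2) + η / 2 * Real.log r)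
        (𝓝[>] 0) atBot :=
      tendsto_atBot_add_const_left _ _
        (Real.tendsto_log_nhdsGT_zero.const_mul_atBot (by linarith))
    obtain ⟨r, hr1, hr2⟩ := ((hlog.eventually_lt_atBot 0).and (Ioo_mem_nhdsGT hr3.1)).exists
    have hr : r ∈ Set.Ioo 0 ρ := ⟨hr2.1, hr2.2.trans hr3.2⟩
    have h7 := hmono hr hr3 hr2.2.le
    have h8 := hw0 r (hεs (hsub r hr)).2.1
    simp only at h7
    linarith
  have hwanti : AntitoneOn w (Set.Ioo 0 ε) := by
    refine antitoneOn_of_deriv_nonpos (convex_Ioo 0 ε)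
      (fun r hr => (hwd r (hεs hr).2.1).continuousAt.continuousWithinAt)
      (fun r hr => ?_) (fun r hr => ?_)
    · rw [interior_Ioo] at hr
      exact (hwd r (hεs hr).2.1).differentiableAt.differentiableWithinAt
    · rw [interior_Ioo] at hr
      rw [(hwd r (hεs hr).2.1).deriv]
      have h1 := hΦle r hr
      rw [hΦeq r] at h1
      have h2 : 0 ≤ betaExp m p σ * (r ^ (N : ℝ) * (g r - f r)) :=
        mul_nonneg hβ.le (mul_nonneg (Real.rpow_nonneg hr.1.le _)
          (sub_nonneg.2 (hle r (hεs hr).2.1)))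
      have h4 : 0 < r ^ ((N : ℝ) - 1) := Real.rpow_pos_of_pos hr.1 _
      exact nonpos_of_mul_nonpos_right (by linarith) h4
  -- `w` is nonnegative, nonincreasing and tends to 0 at the origin, so it vanishes; but one
  -- function cannot solve both equations.
  have heq : ∀ x ∈ Set.Ioo 0 ε, g x = f x := by
    intro x hx
    have h1 : w x ≤ 0 := by
      refine ge_of_tendsto hwlim ?_
      filter_upwards [Ioo_mem_nhdsGT hx.1] with r hr
      exact hwanti ⟨hr.1, hr.2.trans hx.2⟩ hx hr.2.le
    have h2 : g x ^ m ≤ f x ^ m := sub_nonpos.1 h1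
    exact le_antisymm ((Real.rpow_le_rpow_iff (hgpos x (hεs hx).2.1).le
      (hfs x (hεs hx).2.1).1.le hm).1 h2) (hle x (hεs hx).2.1)
  have hx : ε / 2 ∈ Set.Ioo 0 ε := ⟨by linarith, by linarith⟩
  have hxδ := (hεs hx).2.1
  have htouch := profileResidual_le_of_touching (N := N) (m := m) (p := p) (σ := σ) (c := c) hm.le
    (hgs _ hxδ).1 (hfs _ hxδ).2.1 (heq _ hx) (hfs _ hxδ).1
    (by filter_upwards [Ioo_mem_nhds hxδ.1 hxδ.2] with y hy using hle y hy)
  rw [(hgs _ hxδ).2] at htouch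
  have h1 := (hfs _ hxδ).2.2
  have h2 : 0 < (ε / 2) ^ σ * f (ε / 2) ^ p :=
    mul_pos (Real.rpow_pos_of_pos hx.1 _) (Real.rpow_pos_of_pos (hfs _ hxδ).1 _)
  unfold profileResidual at htouch h1
  nlinarith

/-! ### Contact at the origin, `N = 1` -/

theorem HasOriginBehavior.tendsto {N : ℕ} {m p σ : ℝ} {f : ℝ → ℝ} (hσ : -2 < σ) {D : ℝ}
    (hD : 0 < D)
    (h : f ~[𝓝[>] 0] fun ξ => (D - originCoeff N m p σ * ξ ^ (σ + 2)) ^ (1 / (m - p))) :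
    Tendsto f (𝓝[>] 0) (𝓝 (D ^ (1 / (m - p)))) := by
  refine h.symm.tendsto_nhds ?_
  have h1 : Tendsto (fun ξ : ℝ => ξ ^ (σ + 2)) (𝓝[>] 0) (𝓝 0) := by
    have := (Real.continuousAt_rpow_const 0 (σ + 2) (Or.inr (by linarith))).tendsto
    rw [Real.zero_rpow (by linarith)] at this
    exact this.mono_left nhdsWithin_le_nhds
  have h2 := (h1.const_mul (originCoeff N m p σ)).const_sub D
  rw [mul_zero, sub_zero] at h2
  exact h2.rpow_const (Or.inl hD.ne')

theorem IsProfile.tendsto_zero {N : ℕ} {m p σ : ℝ} {f : ℝ → ℝ} (hf : IsProfile N m p σ f) :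
    Tendsto f (𝓝[>] 0) (𝓝 (f 0)) :=
  (hf.continuousOn 0 Set.self_mem_Ici).mono_left (nhdsWithin_mono _ Set.Ioi_subset_Ici_self)

theorem IsProfile.origin_pos {N : ℕ} {m p σ : ℝ} {f : ℝ → ℝ} (hf : IsProfile N m p σ f)
    (hσ : -2 < σ) : 0 < f 0 := by
  obtain ⟨D, hD, h, -⟩ := hf.origin
  rw [tendsto_nhds_unique hf.tendsto_zero (HasOriginBehavior.tendsto hσ hD h)]
  positivity

theorem IsProfile.expansion {m p σ : ℝ} {f : ℝ → ℝ} (hf : IsProfile 1 m p σ f)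
    (hσ : -2 < σ) (hpm : p < m) :
    (fun ξ => f ξ ^ (m - p) - (f 0 ^ (m - p) - originCoeff 1 m p σ * ξ ^ (σ + 2)))
      =o[𝓝[>] 0] fun ξ => ξ ^ (σ + 2) := by
  obtain ⟨D, hD, h, h'⟩ := hf.origin
  have h0 := tendsto_nhds_unique hf.tendsto_zero (HasOriginBehavior.tendsto hσ hD h)
  have h1 : f 0 ^ (m - p) = D := by
    rw [h0, ← Real.rpow_mul hD.le, one_div_mul_cancel (by linarith), Real.rpow_one]
  rw [h1]
  exact h' rfl

/-- After raising to the power `m-p` the constant terms agree, while the coefficient of `-x^(σ+2)`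
is `K` for `f₂` and `K l^(σ+k(p-1)) > K` for the dilation. -/
theorem IsProfile.not_le_dilate_near_origin {m p σ l δ : ℝ} {f₁ f₂ : ℝ → ℝ}
    (hm : 1 < m) (hσ : -1 < σ) (hpc : p < 1 - σ * (m - 1) / 2) (hσ0 : σ < 0)
    (hf₁ : IsProfile 1 m p σ f₁) (hf₂ : IsProfile 1 m p σ f₂) (hl0 : 0 < l) (hl1 : l < 1)
    (h0 : dilate (2 / (m - 1)) l f₁ 0 = f₂ 0) (hδ : 0 < δ)
    (hpos : ∀ x ∈ Set.Ioo 0 δ, 0 < f₁ (l * x) ∧ 0 < f₂ x)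
    (hle : ∀ x ∈ Set.Ioo 0 δ, f₂ x ≤ dilate (2 / (m - 1)) l f₁ x) : False := by
  obtain ⟨hpm, hE, -, -, hexp⟩ := scaling_exponents hm (by linarith : -2 < σ) hpc
  set k := 2 / (m - 1)
  have hE1 : 1 < l ^ (σ + k * (p - 1)) := Real.one_lt_rpow_of_pos_of_lt_one_of_neg hl0 hl1 hE
  have hK : 0 < originCoeff 1 m p σ := by
    unfold originCoeff
    have h1 : 0 < m - p := by linarith
    have h2 : (0 : ℝ) < (1 : ℕ) + σ := by push_cast; linarith
    have h3 : 0 < σ + 2 := by linarith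
    positivity
  have o1 := hf₁.expansion (by linarith) hpm
  have o2 := hf₂.expansion (by linarith) hpm
  set K := originCoeff 1 m p σ
  have hlx : Tendsto (fun x : ℝ => l * x) (𝓝[>] 0) (𝓝[>] 0) := by
    refine tendsto_nhdsWithin_iff.2 ⟨?_, ?_⟩
    · have : Tendsto (fun x : ℝ => l * x) (𝓝 0) (𝓝 (l * 0)) := (continuous_const_mul l).tendsto 0
      rw [mul_zero] at this
      exact this.mono_left nhdsWithin_le_nhds
    · filter_upwards [self_mem_nhdsWithin] with x hx using mul_pos hl0 hx
  have o3 : (fun x => f₁ (l * x) ^ (m - p) - (f₁ 0 ^ (m - p) - K * (l * x) ^ (σ + 2)))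
      =o[𝓝[>] 0] fun x : ℝ => x ^ (σ + 2) := by
    refine (o1.comp_tendsto hlx).trans_isBigO ?_
    refine IsBigO.of_bound (l ^ (σ + 2)) ?_
    filter_upwards [self_mem_nhdsWithin] with x hx
    have hx0 : (0 : ℝ) < x := hx
    simp only [Function.comp]
    rw [Real.mul_rpow hl0.le hx0.le, norm_mul, Real.norm_of_nonneg (Real.rpow_nonneg hl0.le _)]
  have o4 := (o3.const_mul_left (l ^ (-(k * (m - p))))).sub o2
  have hκ : 0 < K * (l ^ (σ + k * (p - 1)) - 1) := mul_pos hK (by linarith)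
  obtain ⟨x, hb, hx⟩ := ((o4.bound (half_pos hκ)).and (Ioo_mem_nhdsGT hδ)).exists
  have hx0 := hx.1
  have hxp : 0 < x ^ (σ + 2) := Real.rpow_pos_of_pos hx0 _
  rw [Real.norm_of_nonneg hxp.le] at hb
  have hb' := (le_abs_self _).trans hb
  have e1 : (l ^ (-k)) ^ (m - p) = l ^ (-(k * (m - p))) := by
    rw [← Real.rpow_mul hl0.le]; ring_nf
  have e2 : f₂ 0 ^ (m - p) = l ^ (-(k * (m - p))) * f₁ 0 ^ (m - p) := by
    rw [← h0]
    simp only [dilate, mul_zero]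
    rw [Real.mul_rpow (by positivity) (hf₁.origin_pos (by linarith)).le, e1]
  have e3 : l ^ (-(k * (m - p))) * l ^ (σ + 2) = l ^ (σ + k * (p - 1)) := by
    rw [← hexp, ← Real.rpow_add hl0]; ring_nf
  have h1 : f₂ x ^ (m - p) ≤ l ^ (-(k * (m - p))) * f₁ (l * x) ^ (m - p) := by
    rw [← e1, ← Real.mul_rpow (by positivity) (hpos x hx).1.le]
    exact Real.rpow_le_rpow (hpos x hx).2.le (hle x hx) (by linarith)
  rw [e2, Real.mul_rpow hl0.le hx0.le] at hb'
  have e4 : l ^ (-(k * (m - p))) * (K * (l ^ (σ + 2) * x ^ (σ + 2)))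
    = l ^ (σ + k * (p - 1)) * (K * x ^ (σ + 2)) := by rw [← e3]; ring
  nlinarith [mul_pos hκ hxp]

theorem IsProfile.solution {N : ℕ} {m p σ ξ : ℝ} {f : ℝ → ℝ} (hf : IsProfile N m p σ f)
    (hpos : ∀ s ∈ Set.Ioo 0 ξ, 0 < f s) :
    ∀ x ∈ Set.Ioo 0 ξ, ContDiffAt ℝ 2 f x ∧ profileResidual N m p σ 1 f x = 0 := by
  intro x hx
  obtain ⟨h1, h2⟩ := hf.solves x hx.1 fun s hs => hpos s ⟨hs.1, hs.2.trans_lt hx.2⟩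
  refine ⟨h1, ?_⟩
  rw [profileResidual, one_mul]
  exact h2

/-! ### First contact and conclusion -/

/-- The first contact, as `l` increases from `0`, of the dilations of `f₁` with `f₂`. -/
theorem exists_first_contact {k ξ : ℝ} {f₁ f₂ : ℝ → ℝ} (hk : 0 < k) (hξ : 0 ≤ ξ)
    (hc₁ : ContinuousOn f₁ (Set.Ici 0)) (hc₂ : ContinuousOn f₂ (Set.Ici 0))
    (h0 : 0 < f₁ 0) (h12 : f₁ 0 < f₂ 0) :
    ∃ l ∈ Set.Ioo (0 : ℝ) 1, ∃ x₀ ∈ Set.Icc 0 ξ, dilate k l f₁ x₀ = f₂ x₀ ∧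
      ∀ x ∈ Set.Icc 0 ξ, f₂ x ≤ dilate k l f₁ x := by
  have hf20 : 0 < f₂ 0 := h0.trans h12
  set S : Set (ℝ × ℝ) := Set.Icc 0 1 ×ˢ Set.Icc 0 ξ
  have hS : IsCompact S := isCompact_Icc.prod isCompact_Icc
  have hA : ContinuousOn (fun z : ℝ × ℝ => f₁ (z.1 * z.2)) S :=
    hc₁.comp (by fun_prop) fun z hz => mul_nonneg hz.1.1 hz.2.1
  -- Multiplying the contact inequality by `l^k` makes it continuous down to `l = 0`, where it fails
  -- because `f₁ 0 > 0`.
  have hB : ContinuousOn (fun z : ℝ × ℝ => z.1 ^ k * f₂ z.2) S :=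
    (continuousOn_fst.rpow_const fun _ _ => Or.inr hk.le).mul
      (hc₂.comp continuousOn_snd fun z hz => hz.2.1)
  have hK : IsCompact (S ∩ (fun z : ℝ × ℝ => z.1 ^ k * f₂ z.2 - f₁ (z.1 * z.2)) ⁻¹' Set.Ici 0) :=
    hS.of_isClosed_subset ((hB.sub hA).preimage_isClosed_of_isClosed hS.isClosed isClosed_Ici)
      Set.inter_subset_left
  set q := f₁ 0 / f₂ 0
  have hq0 : 0 < q := by positivity
  have hq1 : q < 1 := (div_lt_one hf20).2 h12
  have hqk : (q ^ (1 / k)) ^ k = q := by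
    rw [← Real.rpow_mul hq0.le, one_div_mul_cancel hk.ne', Real.rpow_one]
  have hl1 : q ^ (1 / k) < 1 := Real.rpow_lt_one hq0.le hq1 (by positivity)
  -- At this parameter the dilation meets `f₂` at the origin, so the least contact parameter is
  -- below 1.
  have hmem : (q ^ (1 / k), (0 : ℝ)) ∈
      S ∩ (fun z : ℝ × ℝ => z.1 ^ k * f₂ z.2 - f₁ (z.1 * z.2)) ⁻¹' Set.Ici 0 := by
    refine ⟨⟨⟨by positivity, hl1.le⟩, ⟨le_rfl, hξ⟩⟩, ?_⟩
    simp only [Set.mem_preimage, Set.mem_Ici, mul_zero, hqk, q]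
    rw [div_mul_cancel₀ _ hf20.ne', sub_self]
  obtain ⟨⟨l, x₀⟩, ⟨⟨hl, hx₀⟩, hlx⟩, hmin⟩ := hK.exists_isMinOn ⟨_, hmem⟩ continuousOn_fst
  simp only [Set.mem_preimage, Set.mem_Ici, sub_nonneg] at hl hx₀ hlx
  have hl0 : 0 < l := by
    refine lt_of_le_of_ne hl.1 ?_
    rintro rfl
    rw [Real.zero_rpow hk.ne', zero_mul, zero_mul] at hlx
    linarith
  have hlt : l < 1 := lt_of_le_of_lt (hmin hmem) hl1
  have hge : ∀ x ∈ Set.Icc 0 ξ, l ^ k * f₂ x ≤ f₁ (l * x) := by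
    intro x hx
    -- By minimality of `l` there is no contact for `t < l`; the order passes to the limit.
    have hev : ∀ᶠ t in 𝓝[<] l, t ^ k * f₂ x ≤ f₁ (t * x) := by
      filter_upwards [Ioo_mem_nhdsLT hl0] with t ht
      by_contra! hcon
      have : l ≤ t := hmin (show (t, x) ∈ _ from
        ⟨⟨⟨ht.1.le, (ht.2.trans hlt).le⟩, hx⟩, by
          simp only [Set.mem_preimage, Set.mem_Ici]; linarith⟩)
      linarith [ht.2]
    have t1 : Tendsto (fun t : ℝ => t ^ k * f₂ x) (𝓝[<] l) (𝓝 (l ^ k * f₂ x)) :=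
      ((Real.continuousAt_rpow_const l k (Or.inr hk.le)).tendsto.mono_left
        nhdsWithin_le_nhds).mul_const _
    have t2 : Tendsto (fun t : ℝ => f₁ (t * x)) (𝓝[<] l) (𝓝 (f₁ (l * x))) := by
      refine Tendsto.comp (hc₁ (l * x) (mul_nonneg hl.1 hx.1)) (tendsto_nhdsWithin_iff.2 ⟨?_, ?_⟩)
      · exact ((continuous_mul_const x).tendsto l).mono_left nhdsWithin_le_nhds
      · filter_upwards [Ioo_mem_nhdsLT hl0] with t ht using mul_nonneg ht.1.le hx.1
    exact le_of_tendsto_of_tendsto t1 t2 hev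
  have hlk : 0 < l ^ k := by positivity
  refine ⟨l, ⟨hl0, hlt⟩, x₀, hx₀, ?_, fun x hx => ?_⟩
  · rw [dilate, Real.rpow_neg hl0.le, le_antisymm hlx (hge x₀ hx₀), inv_mul_cancel_left₀ hlk.ne']
  · rw [dilate, Real.rpow_neg hl0.le, ← div_eq_inv_mul, le_div_iff₀ hlk, mul_comm]
    exact hge x hx

theorem IsZeroOrPositiveMin.pos {f : ℝ → ℝ} {ξ : ℝ} (h : IsZeroOrPositiveMin f ξ) :
    ∀ s ∈ Set.Ioo 0 ξ, 0 < f s := by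
  rcases h.2 with h | h
  · exact h.2
  · exact fun s hs => h.1.trans_le (h.2 hs.1)

theorem mainTheorem3 (N : ℕ) (m p σ : ℝ)
    (hm : 1 < m) (hσ : -2 < σ) (hσ0 : σ < 0)
    (hp : 1 ≤ p) (hpc : p < 1 - σ * (m - 1) / 2)
    (hN : 2 ≤ N ∨ (N = 1 ∧ -1 < σ))
    (f₁ f₂ : ℝ → ℝ) (hf₁ : IsProfile N m p σ f₁) (hf₂ : IsProfile N m p σ f₂)
    (h0 : f₁ 0 < f₂ 0)
    (ξmin : ℝ) (hmin : IsZeroOrPositiveMin f₁ ξmin) :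
    ∀ ξ ∈ Set.Ioo 0 ξmin, f₁ ξ < f₂ ξ := by
  intro ξ hξ
  by_contra! hcon
  obtain ⟨hpm, hE, hβ, -, -⟩ := scaling_exponents hm hσ hpc
  have hm1 : 0 < m - 1 := by linarith
  have hN1 : 1 ≤ N := by omega
  have hk0 : 0 < 2 / (m - 1) := by positivity
  have hpos1 := hmin.pos
  have h10 := hf₁.origin_pos hσ
  have hsub : Set.Icc 0 ξ ⊆ Set.Ici 0 := fun x hx => hx.1
  have hT : IsCompact (Set.Icc 0 ξ ∩ (fun x => f₁ x - f₂ x) ⁻¹' Set.Ici 0) :=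
    isCompact_Icc.of_isClosed_subset
      (((hf₁.continuousOn.mono hsub).sub (hf₂.continuousOn.mono hsub)).preimage_isClosed_of_isClosed
        isClosed_Icc isClosed_Ici) Set.inter_subset_left
  obtain ⟨b, ⟨hb, hb'⟩, hbmin⟩ := hT.exists_isMinOn
    ⟨ξ, ⟨hξ.1.le, le_rfl⟩, sub_nonneg.2 hcon⟩ continuousOn_id
  simp only [Set.mem_preimage, Set.mem_Ici, sub_nonneg] at hb'
  have hb0 : 0 < b := by
    refine lt_of_le_of_ne hb.1 ?_
    rintro rfl
    linarith
  have hbξ : b < ξmin := hb.2.trans_lt hξ.2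
  have hlt : ∀ x ∈ Set.Ico 0 b, f₁ x < f₂ x := by
    intro x hx
    by_contra! hc
    have : b ≤ x := hbmin (show x ∈ _ from ⟨⟨hx.1, hx.2.le.trans hb.2⟩, sub_nonneg.2 hc⟩)
    linarith [hx.2]
  have hpos2 : ∀ x ∈ Set.Ioo 0 b, 0 < f₂ x := fun x hx =>
    (hpos1 x ⟨hx.1, hx.2.trans hbξ⟩).trans (hlt x ⟨hx.1.le, hx.2⟩)
  have hsol1 := hf₁.solution hpos1
  have hsol2 := hf₂.solution hpos2
  obtain ⟨l, ⟨hl0, hl1⟩, x₀, hx₀, htouch, hge⟩ :=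
    exists_first_contact hk0 hb0.le hf₁.continuousOn hf₂.continuousOn h10 h0
  have hmem : ∀ x, 0 < x → x ≤ b → l * x ∈ Set.Ioo 0 ξmin := fun x hx hxb =>
    ⟨mul_pos hl0 hx, by nlinarith⟩
  have hsolG : ∀ x ∈ Set.Ioo 0 b, ContDiffAt ℝ 2 (dilate (2 / (m - 1)) l f₁) x ∧
      profileResidual N m p σ (l ^ (σ + 2 / (m - 1) * (p - 1))) (dilate (2 / (m - 1)) l f₁) x
        = 0 := by
    intro x hx
    have hx' := hmem x hx.1 hx.2.le
    refine ⟨contDiffAt_dilate (hsol1 _ hx').1, ?_⟩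
    rw [profileResidual_dilate hm hl0 hx.1 (hsol1 _ hx').1.continuousAt (hpos1 _ hx'),
      (hsol1 _ hx').2, mul_zero]
  have hc1 : 1 < l ^ (σ + 2 / (m - 1) * (p - 1)) :=
    Real.one_lt_rpow_of_pos_of_lt_one_of_neg hl0 hl1 hE
  rcases eq_or_lt_of_le hx₀.1 with hx0 | hx0
  · subst hx0
    rcases hN with hN2 | ⟨rfl, hσ1⟩
    · refine not_le_near_origin (by linarith) hσ0 hβ hN2 hc1 hb0 (h10.trans h0) hf₂.tendsto_zero ?_
        (fun x hx => ⟨hpos2 x hx, hsol2 x hx⟩) hsolG (fun x hx => hge x ⟨hx.1.le, hx.2.le⟩)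
      rw [← htouch]
      refine Tendsto.const_mul _ ?_
      refine Tendsto.comp (hf₁.continuousOn (l * 0) (by simp)) (tendsto_nhdsWithin_iff.2 ⟨?_, ?_⟩)
      · exact ((continuous_const_mul l).tendsto 0).mono_left nhdsWithin_le_nhds
      · filter_upwards [self_mem_nhdsWithin] with x hx
        exact mul_nonneg hl0.le (le_of_lt hx)
    · exact hf₁.not_le_dilate_near_origin hm hσ1 hpc hσ0 hf₂ hl0 hl1 htouch hb0
        (fun x hx => ⟨hpos1 _ (hmem x hx.1 hx.2.le), hpos2 x hx⟩)
        (fun x hx => hge x ⟨hx.1.le, hx.2.le⟩)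
  · rcases eq_or_lt_of_le hx₀.2 with hxb | hxb
    · subst hxb
      have h1 := mul_rpow_neg_lt_of_solution hm hσ hpc hN1 hf₁.continuousOn h10 hpos1 hsol1
        (hmem x₀ hx0 le_rfl).1 (show l * x₀ < x₀ by nlinarith) hbξ
      rw [Real.mul_rpow hl0.le hx0.le, ← mul_assoc] at h1
      have h2 := lt_of_mul_lt_mul_right h1 (Real.rpow_nonneg hx0.le _)
      rw [dilate] at htouch
      linarith
    · have hx : x₀ ∈ Set.Ioo 0 b := ⟨hx0, hxb⟩
      have h1 := profileResidual_le_of_touching (N := N) (m := m) (p := p) (σ := σ) (c := 1)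
        (by linarith) (hsolG _ hx).1 (hsol2 _ hx).1 htouch (hpos2 _ hx)
        (by filter_upwards [Ioo_mem_nhds hx0 hxb] with y hy using hge y ⟨hy.1.le, hy.2.le⟩)
      rw [(hsol2 _ hx).2] at h1
      have h2 := (hsolG _ hx).2
      have h3 : 0 < x₀ ^ σ * dilate (2 / (m - 1)) l f₁ x₀ ^ p := by
        rw [htouch]
        exact mul_pos (Real.rpow_pos_of_pos hx0 _) (Real.rpow_pos_of_pos (hpos2 _ hx) _)
      unfold profileResidual at h1 h2
      nlinarith
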